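/- Let $\mu$ be a Borel probability measure on $\mathbb R$ with distribution function $F_\mu$, and let $\epsilon>0$. For probability measures $\mu,\nu$ on $\mathbb R$ let $$d_\epsilon(\mu,\nu)=\inf\{y>0 : F_{\mu}\bigl((x-y/\epsilon)-\bigr)-y\le F_\nu(x)\le F_\mu(x+y/\epsilon)+y \ \text{ for all } x\in\mathbb R\}$$ be the $\epsilon$-Lévy metric, where $F_\mu(z-)=\lim_{\eta\downarrow0}F_\mu(z-\eta)$. For $n\ge1$, a best uniform $d_\epsilon$-approximation $\delta_\bullet^{u_n}$ of $\mu$ is a measure $\frac1n\sum_{j=1}^n\delta_{x_j}$ with $x_1\le\dots\le x_n$ that minimizes $d_\epsilon(\mu,\cdot)$ among all measures of this form. The inverse measure $\mu^{-1}$ is the Borel measure on $\mathbb R$ concentrated on $]0,1[$ with $\mu^{-1}(]s,t])=F_\mu^{-1}(t)-F_\mu^{-1}(s)$ for all $0<s\le t<1$, where $F_\mu^{-1}(t)=\sup\{y\in\mathbb R: F_\mu(y)\le t\}$. Let $\Omega(x)=x/(2+2|x|)$ for $x\in\mathbb R$ and $\Omega(+\infty)=\frac12$. A best uniform $d_\epsilon$-approximation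 of $\mu$ exists for every $n\ge 1$. Let $\omega_n=n\,d_\epsilon(\mu,\delta_\bullet^{u_n})$, for any choice of best uniform $d_\epsilon$-approximations $\delta_\bullet^{u_n}$, $n\ge 1$. (i) If $\limsup_{n\to\infty}\omega_n<\frac13$, then $(\omega_n)$ converges, and $\mu^{-1}$ is absolutely continuous with respect to Lebesgue measure. (ii) If $\limsup_{n\to\infty}\omega_n\ge\frac13$, then $(\omega_n)$ converges or (possibly both) $$\limsup_{n\to\infty}\omega_n\in\Bigl\{\tfrac13,\tfrac25,\tfrac37,\dots,\tfrac12\Bigr\}=\bigl\{\Omega(2m): m\in\{1,2,3,\dots\}\cup\{+\infty\}\bigr\},$$ where the first set is $\{\frac{m}{2m+1}: m\ge 1\}\cup\{\frac12\}$. -/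

import Mathlib

open MeasureTheory Filter Topology
open scoped ENNReal

noncomputable section

namespace Levy

/-- The `ε`-Lévy distance `d_ε(f, g)` of two real distribution functions: the infimum of all `y > 0`
with `f₋(x - y/ε) - y ≤ g x ≤ f (x + y/ε) + y` for every real `x`, where `f₋` is the left limit. -/
def distFun (ε : ℝ) (f g : ℝ → ℝ) : ℝ :=
  sInf {y : ℝ | 0 < y ∧
    ∀ x : ℝ, Function.leftLim f (x - y / ε) - y ≤ g x ∧ g x ≤ f (x + y / ε) + y}

/-- The `ε`-Lévy distance of two probability measures on the real line. -/
def dist (ε : ℝ) (μ ν : Measure ℝ) : ℝ :=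
  distFun ε (ProbabilityTheory.cdf μ) (ProbabilityTheory.cdf ν)

/-- The discrete measure with weight `p j` at the point `x j`. -/
def discrete {n : ℕ} (x p : Fin n → ℝ) : Measure ℝ :=
  ∑ j, ENNReal.ofReal (p j) • Measure.dirac (x j)

/-- The uniform weights `(1/n, …, 1/n)`. -/
def unif (n : ℕ) : Fin n → ℝ := fun _ => (n : ℝ)⁻¹

/-- `discrete x p` is a best `d_ε`-approximation of `μ`, given the weights `p`, where the locations
range over all non-decreasing `n`-tuples. -/
def IsBestGiven (ε : ℝ) (μ : Measure ℝ) {n : ℕ} (p x : Fin n → ℝ) : Prop :=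
  Monotone x ∧
    ∀ y : Fin n → ℝ, Monotone y → dist ε μ (discrete x p) ≤ dist ε μ (discrete y p)

/-- `discrete x (unif n)` is a best uniform `d_ε`-approximation of `μ`. -/
def IsBestUniform (ε : ℝ) (μ : Measure ℝ) {n : ℕ} (x : Fin n → ℝ) : Prop :=
  IsBestGiven ε μ (unif n) x

/-- The upper quantile function `sup {y | F_μ y ≤ t}`; it is used for `0 < t < 1` only, where the
set is non-empty and bounded above. -/
def quantile (μ : Measure ℝ) (t : ℝ) : ℝ :=
  sSup {y : ℝ | ProbabilityTheory.cdf μ y ≤ t}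

theorem quantile_set_nonempty (μ : Measure ℝ) {t : ℝ} (ht : 0 < t) :
    {y : ℝ | ProbabilityTheory.cdf μ y ≤ t}.Nonempty := by
  obtain ⟨y, hy⟩ := ((ProbabilityTheory.tendsto_cdf_atBot μ).eventually_lt_const ht).exists
  exact ⟨y, hy.le⟩

theorem quantile_set_bddAbove (μ : Measure ℝ) {t : ℝ} (ht : t < 1) :
    BddAbove {y : ℝ | ProbabilityTheory.cdf μ y ≤ t} := by
  obtain ⟨z, hz⟩ := ((ProbabilityTheory.tendsto_cdf_atTop μ).eventually_const_lt ht).exists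
  refine ⟨z, fun y hy => ?_⟩
  by_contra! h
  exact absurd ((ProbabilityTheory.cdf μ).mono h.le) (not_le.2 (lt_of_le_of_lt hy hz))

theorem quantile_mono (μ : Measure ℝ) {s t : ℝ} (hs : 0 < s) (hst : s ≤ t) (ht : t < 1) :
    quantile μ s ≤ quantile μ t :=
  csSup_le_csSup (quantile_set_bddAbove μ ht) (quantile_set_nonempty μ hs)
    fun _ hy => le_trans hy hst

theorem quantile_rightCts (μ : Measure ℝ) (t : Set.Ioo (0 : ℝ) 1) :
    ContinuousWithinAt (fun s : Set.Ioo (0 : ℝ) 1 => quantile μ s) (Set.Ici t) t := by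
  refine tendsto_order.2 ⟨fun a ha => ?_, fun a ha => ?_⟩
  · filter_upwards [self_mem_nhdsWithin] with s hs
    exact lt_of_lt_of_le ha (quantile_mono μ t.2.1 hs s.2.2)
  · obtain ⟨z, hz1, hz2⟩ := exists_between ha
    have hF : (t : ℝ) < ProbabilityTheory.cdf μ z := by
      by_contra! h
      exact absurd (le_csSup (quantile_set_bddAbove μ t.2.2) h) (not_le.2 hz1)
    have : ∀ᶠ s : Set.Ioo (0 : ℝ) 1 in 𝓝 t, (s : ℝ) < ProbabilityTheory.cdf μ z :=
      continuous_subtype_val.continuousAt.eventually_lt_const hF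
    filter_upwards [nhdsWithin_le_nhds this] with s hs
    refine lt_of_le_of_lt (csSup_le (quantile_set_nonempty μ s.2.1) fun y hy => ?_) hz2
    by_contra! h
    exact absurd ((ProbabilityTheory.cdf μ).mono h.le) (not_le.2 (lt_of_le_of_lt hy hs))

/-- The upper quantile function on `]0, 1[` as a Stieltjes function. -/
def quantileStieltjes (μ : Measure ℝ) : StieltjesFunction (Set.Ioo (0 : ℝ) 1) where
  toFun t := quantile μ t
  mono' s t hst := quantile_mono μ s.2.1 hst t.2.2
  right_continuous' t := quantile_rightCts μ t

instance compactIcc_Ioo : CompactIccSpace (Set.Ioo (0 : ℝ) 1) where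
  isCompact_Icc {a b} := by
    rw [Subtype.isCompact_iff]
    convert isCompact_Icc (a := (a : ℝ)) (b := (b : ℝ)) using 1
    ext z
    constructor
    · rintro ⟨w, hw, rfl⟩
      exact hw
    · intro hz
      exact ⟨⟨z, lt_of_lt_of_le a.2.1 hz.1, lt_of_le_of_lt hz.2 b.2.2⟩, hz, rfl⟩

/-- The inverse measure of `μ`: the Borel measure on the real line that is concentrated on `]0, 1[`
and gives mass `quantile μ t - quantile μ s` to `]s, t]` whenever `0 < s ≤ t < 1`. -/
def inverseMeasure (μ : Measure ℝ) : Measure ℝ :=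
  (quantileStieltjes μ).measure.map Subtype.val

/-- `Ω(x) = x / (2 + 2|x|)` for real `x`, with `Ω(±∞) = ±1/2`. -/
def Omega (x : EReal) : ℝ :=
  if x = ⊤ then 1 / 2 else if x = ⊥ then -(1 / 2) else x.toReal / (2 + 2 * |x.toReal|)

/-- The set `{Ω(2m) : m ∈ ℕ ∪ {+∞}}`, with `m ≥ 1`. -/
def OmegaValues : Set ℝ :=
  {y | ∃ m : ℕ∞, 1 ≤ m ∧ y = Omega (2 * ((m : ℝ≥0∞) : EReal))}

end Levy

end

/-!
The proof rests on a reformulation through the inverse measure `ν = μ⁻¹`. A number `y > 0` is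
admissible for the distance from `μ` to some uniform discrete measure with `n` locations if and only
if `ν` gives mass at most `2 y / ε` to each of the intervals `]j / n + y, (j + 1) / n - y[`,
`0 ≤ j < n`: the location `x j` can be chosen if and only if the two ends of the corresponding
quantile interval lie within `y / ε` of it. Writing `y = w / n`, this is the condition `GapBound`,
which becomes weaker as `w` grows, is closed under decreasing limits of `w`, and is vacuous for `w = 1 / 2`. Hence best
approximations exist and `ω n` is the least `w ≥ 0` for which `GapBound` holds
(`gapBound_of_lt`, `GapBound.dist_le_of_isBestUniform`, `exists_isBestUniform`).

A point `p` lies in a level interval of index `n` if and only if `n p` is further than `w` from the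
integers. The multiples of `p` all stay within `k / (2 k + 1)` of the integers if `p` is a fraction
with odd denominator at most `2 k + 1`; for every other `p` they are infinitely often at distance at
least `(k + 1) / (2 k + 3)`, up to an arbitrarily small error
(`frequently_fract_mul_of_notMem_oddFractions`). So if `limsup ω < (k + 1) / (2 k + 3)`, then `ν` has
a finite lower derivative, with a uniform bound, at all points outside the set `oddFractions k`, and
the Besicovitch covering theorem shows that `ν` is bounded there by a multiple of Lebesgue measure
(`exists_inverseMeasure_le_of_eventually_gapBound`). For `k = 0` this is absolute continuity.

Suppose moreover `k / (2 k + 1) < limsup ω`, or `k = 0`, and that `liminf ω < w < limsup ω` for some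
`w > k / (2 k + 1)`. Lebesgue differentiation along the infinitely many `n` with `ω n < w` bounds the
density of `ν` outside `oddFractions k` by `2 w / ((1 - 2 w) ε)`
(`inverseMeasure_le_of_frequently_gapBound`). As the level intervals contain no point of
`oddFractions k`, this bound gives back `GapBound` for every `n`
(`gapBound_of_inverseMeasure_le`), whence `limsup ω ≤ w`, a contradiction. Thus `ω` converges unless
`limsup ω` is one of the values `k / (2 k + 1)`, `k ≥ 1`, or `1 / 2`.
-/

namespace Levy

/-! ### Quantiles and distribution functions -/

theorem lt_cdf_of_quantile_lt (μ : Measure ℝ) {t z : ℝ} (ht : t < 1) (h : quantile μ t < z) :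
    t < ProbabilityTheory.cdf μ z := by
  by_contra! h'
  exact absurd (le_csSup (quantile_set_bddAbove μ ht) h') (not_le.2 h)

theorem cdf_le_of_lt_quantile (μ : Measure ℝ) {t z : ℝ} (ht : 0 < t) (h : z < quantile μ t) :
    ProbabilityTheory.cdf μ z ≤ t := by
  obtain ⟨y, hy, hzy⟩ := exists_lt_of_lt_csSup (quantile_set_nonempty μ ht) h
  exact le_trans ((ProbabilityTheory.cdf μ).mono hzy.le) hy

theorem quantile_le_of_lt_cdf (μ : Measure ℝ) {t z : ℝ} (ht : 0 < t)
    (h : t < ProbabilityTheory.cdf μ z) : quantile μ t ≤ z := by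
  by_contra! h'
  exact absurd (cdf_le_of_lt_quantile μ ht h') (not_le.2 h)

theorem le_quantile_of_cdf_le (μ : Measure ℝ) {t z : ℝ} (ht : t < 1)
    (h : ProbabilityTheory.cdf μ z ≤ t) : z ≤ quantile μ t :=
  le_csSup (quantile_set_bddAbove μ ht) h

theorem le_cdf_of_quantile_le (μ : Measure ℝ) {t z : ℝ} (ht : t < 1) (h : quantile μ t ≤ z) :
    t ≤ ProbabilityTheory.cdf μ z := by
  have hc : Tendsto (ProbabilityTheory.cdf μ) (𝓝[>] z) (𝓝 (ProbabilityTheory.cdf μ z)) :=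
    ((ProbabilityTheory.cdf μ).right_continuous z).mono Set.Ioi_subset_Ici_self
  refine ge_of_tendsto hc ?_
  filter_upwards [self_mem_nhdsWithin] with y hy
  exact (lt_cdf_of_quantile_lt μ ht (lt_of_le_of_lt h hy)).le

/-! ### The distribution function of a uniform discrete measure -/

theorem discrete_unif_Iic {n : ℕ} (x : Fin n → ℝ) (z : ℝ) :
    discrete x (unif n) (Set.Iic z) =
      ENNReal.ofReal (((Finset.univ.filter fun j => x j ≤ z).card : ℝ) / n) := by
  have : ∀ j : Fin n, (ENNReal.ofReal ((n : ℝ)⁻¹) • Measure.dirac (x j)) (Set.Iic z)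
      = if x j ≤ z then ENNReal.ofReal ((n : ℝ)⁻¹) else 0 := by
    intro j
    rw [Measure.smul_apply, Measure.dirac_apply' _ measurableSet_Iic]
    by_cases h : x j ≤ z <;> simp [h]
  simp only [discrete, unif, Measure.finsetSum_apply, this]
  rw [← Finset.sum_filter, Finset.sum_const, nsmul_eq_mul, div_eq_mul_inv,
    ENNReal.ofReal_mul (Nat.cast_nonneg _), ENNReal.ofReal_natCast]

theorem isProbabilityMeasure_discrete_unif {n : ℕ} (hn : 1 ≤ n) (x : Fin n → ℝ) :
    IsProbabilityMeasure (discrete x (unif n)) := by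
  have hn' : (n : ℝ) ≠ 0 := by positivity
  constructor
  simp only [discrete, unif, Measure.finsetSum_apply, Measure.smul_apply, measure_univ]
  rw [Finset.sum_const, Finset.card_univ, Fintype.card_fin, smul_eq_mul, mul_one, nsmul_eq_mul,
    ← ENNReal.ofReal_natCast, ← ENNReal.ofReal_mul (Nat.cast_nonneg _), mul_inv_cancel₀ hn',
    ENNReal.ofReal_one]

theorem cdf_discrete_unif {n : ℕ} (hn : 1 ≤ n) (x : Fin n → ℝ) (z : ℝ) :
    ProbabilityTheory.cdf (discrete x (unif n)) z =
      ((Finset.univ.filter fun j => x j ≤ z).card : ℝ) / n := by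
  have := isProbabilityMeasure_discrete_unif hn x
  rw [ProbabilityTheory.cdf_eq_real, measureReal_def, discrete_unif_Iic,
    ENNReal.toReal_ofReal (by positivity)]

/-- For a monotone tuple the locations `≤ z` form an initial segment: its length `m` determines the
value of the distribution function. -/
theorem exists_cdf_discrete_unif_eq {n : ℕ} (hn : 1 ≤ n) {x : Fin n → ℝ} (hx : Monotone x) (z : ℝ) :
    ∃ m : ℕ, m ≤ n ∧ ProbabilityTheory.cdf (discrete x (unif n)) z = (m : ℝ) / n ∧
      ∀ j : Fin n, x j ≤ z ↔ (j : ℕ) < m := by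
  set S := Finset.univ.filter fun j => x j ≤ z with hS
  refine ⟨S.card, by simpa using Finset.card_le_univ S, cdf_discrete_unif hn x z, fun j => ?_⟩
  constructor
  · intro hj
    have : Finset.Iic j ⊆ S := fun i hi => by
      simp only [hS, Finset.mem_filter, Finset.mem_univ, true_and]
      exact (hx (Finset.mem_Iic.1 hi)).trans hj
    have h := Finset.card_le_card this
    rw [Fin.card_Iic] at h
    omega
  · intro hj
    by_contra! h
    have : S ⊆ Finset.Iio j := fun i hi => by
      simp only [hS, Finset.mem_filter, Finset.mem_univ, true_and] at hi
      exact Finset.mem_Iio.2 (hx.reflect_lt (lt_of_le_of_lt hi h))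
    have h := Finset.card_le_card this
    rw [Fin.card_Iio] at h
    omega

/-! ### The Lévy distance to uniform discrete measures -/

/-- The admissible set whose infimum is `distFun ε f g`. -/
def admissible (ε : ℝ) (f g : ℝ → ℝ) : Set ℝ :=
  {y : ℝ | 0 < y ∧
    ∀ x : ℝ, Function.leftLim f (x - y / ε) - y ≤ g x ∧ g x ≤ f (x + y / ε) + y}

theorem admissible_bddBelow (ε : ℝ) (f g : ℝ → ℝ) : BddBelow (admissible ε f g) :=
  ⟨0, fun _ hy => hy.1.le⟩

theorem one_mem_admissible_cdf (ε : ℝ) (μ ν : Measure ℝ) :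
    1 ∈ admissible ε (ProbabilityTheory.cdf μ) (ProbabilityTheory.cdf ν) := by
  refine ⟨one_pos, fun x => ⟨?_, ?_⟩⟩
  · have h1 := (ProbabilityTheory.cdf μ).mono.leftLim_le (le_refl (x - 1 / ε))
    have h2 := ProbabilityTheory.cdf_le_one μ (x - 1 / ε)
    have h3 := ProbabilityTheory.cdf_nonneg ν x
    linarith
  · have h2 := ProbabilityTheory.cdf_nonneg μ (x + 1 / ε)
    have h3 := ProbabilityTheory.cdf_le_one ν x
    linarith

/-- The condition that the inverse measure gives mass at most `2 w / (n ε)` to each of the intervals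
`](j + w) / n, (j + 1 - w) / n[`, `0 ≤ j < n`, expressed through increments of the quantile
function. The smallest such `w ≥ 0` is `n` times the distance from `μ` to its best uniform
approximations. -/
def GapBound (ε : ℝ) (μ : Measure ℝ) (n : ℕ) (w : ℝ) : Prop :=
  ∀ j : ℕ, j < n → ∀ s t : ℝ, (j + w) / n < s → s ≤ t → t < (j + 1 - w) / n →
    quantile μ t - quantile μ s ≤ 2 * w / (n * ε)

theorem GapBound.mono {ε : ℝ} (hε : 0 < ε) {μ : Measure ℝ} {n : ℕ} {w w' : ℝ} (hw : w ≤ w')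
    (h : GapBound ε μ n w) : GapBound ε μ n w' := by
  intro j hj s t hs hst ht
  refine (h j hj s t (lt_of_le_of_lt ?_ hs) hst (lt_of_lt_of_le ht ?_)).trans ?_ <;> gcongr

theorem gapBound_half (ε : ℝ) (μ : Measure ℝ) (n : ℕ) : GapBound ε μ n (1 / 2) := by
  intro j _ s t hs hst ht
  have : ((j : ℝ) + 1 - 1 / 2) / n = (j + 1 / 2) / n := by ring
  rw [this] at ht
  linarith

theorem gapBound_of_forall_gt {ε : ℝ} {μ : Measure ℝ} {n : ℕ} {w : ℝ}
    (h : ∀ w' > w, GapBound ε μ n w') : GapBound ε μ n w := by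
  intro j hj s t hs hst ht
  have h1 : Tendsto (fun w' : ℝ => 2 * w' / (n * ε)) (𝓝[>] w) (𝓝 (2 * w / (n * ε))) :=
    tendsto_nhdsWithin_of_tendsto_nhds (Continuous.tendsto (by fun_prop) w)
  have h2 : ∀ᶠ w' in 𝓝[>] w, ((j : ℝ) + w') / n < s :=
    nhdsWithin_le_nhds ((Continuous.tendsto (by fun_prop) w).eventually_lt_const hs)
  have h3 : ∀ᶠ w' in 𝓝[>] w, t < ((j : ℝ) + 1 - w') / n :=
    nhdsWithin_le_nhds ((Continuous.tendsto (by fun_prop) w).eventually_const_lt ht)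
  refine ge_of_tendsto h1 ?_
  filter_upwards [h2, h3, self_mem_nhdsWithin] with w' h2 h3 h4
  exact h w' h4 j hj s t h2 hst h3

/-- The location `x j` has to be within `y / ε` of the whole quantile interval with levels strictly
between `j / n + y` and `(j + 1) / n - y`. -/
theorem gapBound_of_mem_admissible {ε : ℝ} (hε : 0 < ε) (μ : Measure ℝ) {n : ℕ}
    (hn : 1 ≤ n) {x : Fin n → ℝ} (hx : Monotone x) {y : ℝ}
    (hy : y ∈ admissible ε (ProbabilityTheory.cdf μ)
      (ProbabilityTheory.cdf (discrete x (unif n)))) : GapBound ε μ n (n * y) := by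
  have hn' : (0 : ℝ) < n := by positivity
  intro j hj s t hs hst ht
  obtain ⟨hy0, hy⟩ := hy
  rw [add_div, mul_div_cancel_left₀ _ hn'.ne'] at hs
  rw [sub_div, mul_div_cancel_left₀ _ hn'.ne'] at ht
  have hj0 : (0 : ℝ) ≤ j / n := by positivity
  have hj1 : ((j : ℝ) + 1) / n ≤ 1 := by
    rw [div_le_one hn']; exact_mod_cast hj
  have hmul : 2 * (n * y) / (n * ε) = 2 * (y / ε) := by field_simp
  rw [hmul]
  have hupper : quantile μ t ≤ x ⟨j, hj⟩ + y / ε := by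
    refine quantile_le_of_lt_cdf μ (by linarith) ?_
    obtain ⟨m, -, hm, hmx⟩ := exists_cdf_discrete_unif_eq hn hx (x ⟨j, hj⟩)
    have h1 := (hmx ⟨j, hj⟩).1 le_rfl
    have h2 := (hy (x ⟨j, hj⟩)).2
    rw [hm] at h2
    have h3 : ((j : ℝ) + 1) / n ≤ m / n := by
      gcongr; exact_mod_cast h1
    linarith
  have hlower : x ⟨j, hj⟩ - y / ε ≤ quantile μ s := by
    refine le_of_forall_lt fun z hz => ?_
    obtain ⟨z₁, hz₁, hz₁'⟩ := exists_between hz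
    obtain ⟨z₂, hz₂, hz₂'⟩ := exists_between hz₁'
    refine lt_of_lt_of_le hz₁ (le_quantile_of_cdf_le μ (by linarith) ?_)
    obtain ⟨m, -, hm, hmx⟩ := exists_cdf_discrete_unif_eq hn hx (z₂ + y / ε)
    have h1 : m ≤ j := by
      by_contra! h
      have := (hmx ⟨j, hj⟩).2 h
      linarith
    have h2 := (hy (z₂ + y / ε)).1
    rw [hm, add_sub_cancel_right] at h2
    have h3 : (m : ℝ) / n ≤ j / n := by gcongr
    have h4 := (ProbabilityTheory.cdf μ).mono.le_leftLim hz₂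
    linarith
  linarith

/-- Locations that realise a given `GapBound`: `x j` is the least location compatible with all
levels below `(j + 1 - w) / n`, and `GapBound` says that it is not too large for the levels above
`(j + w) / n`. If `w = 0`, the distance vanishes, but `0` is not admissible; hence the range of `y` in
the conclusion. -/
theorem GapBound.exists_admissible {ε : ℝ} (hε : 0 < ε) {μ : Measure ℝ} {n : ℕ} (hn : 1 ≤ n) {w : ℝ}
    (hw0 : 0 ≤ w) (hw1 : w < 1) (h : GapBound ε μ n w) :
    ∃ x : Fin n → ℝ, Monotone x ∧ ∀ y : ℝ, 0 < y → w / n ≤ y →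
      y ∈ admissible ε (ProbabilityTheory.cdf μ) (ProbabilityTheory.cdf (discrete x (unif n))) := by
  have hn' : (0 : ℝ) < n := by positivity
  set T : ℕ → Set ℝ := fun j => quantile μ '' Set.Ioo 0 ((j + 1 - w) / n) with hT
  have hpos : ∀ j : ℕ, (0 : ℝ) < (j + 1 - w) / n := fun j =>
    div_pos (by have : (0 : ℝ) ≤ j := Nat.cast_nonneg j
                linarith) hn'
  have hle1 : ∀ j : ℕ, j < n → ((j : ℝ) + 1 - w) / n ≤ 1 := fun j hj => by
    rw [div_le_one hn']
    have : (j : ℝ) + 1 ≤ n := by exact_mod_cast hj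
    linarith
  have hTne : ∀ j, (T j).Nonempty := fun j => (Set.nonempty_Ioo.2 (hpos j)).image _
  have hTle : ∀ j : ℕ, j < n → ∀ s : ℝ, (j + w) / n < s → s < 1 →
      ∀ z ∈ T j, z ≤ quantile μ s + 2 * w / (n * ε) := by
    rintro j hj s hs hs1 _ ⟨t, ht, rfl⟩
    rcases le_total s t with hst | hst
    · linarith [h j hj s t hs hst ht.2]
    · have h1 := quantile_mono μ ht.1 hst hs1
      have : 0 ≤ 2 * w / (n * ε) := by positivity
      linarith
  have hTbdd : ∀ j : ℕ, j < n → BddAbove (T j) := fun j hj => by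
    have : ((j : ℝ) + w) / n < 1 := by
      rw [div_lt_one hn']
      have : (j : ℝ) + 1 ≤ n := by exact_mod_cast hj
      linarith
    obtain ⟨s, hs, hs1⟩ := exists_between this
    exact ⟨_, hTle j hj s hs hs1⟩
  have hcw : 2 * w / (n * ε) = 2 * (w / n / ε) := by field_simp
  have hmono : Monotone fun j : Fin n => sSup (T j) - w / n / ε := by
    intro i j hij
    refine sub_le_sub_right (csSup_le_csSup (hTbdd j j.2) (hTne i) ?_) _
    refine Set.image_mono (Set.Ioo_subset_Ioo_right ?_)
    have : ((i : ℕ) : ℝ) ≤ (j : ℕ) := by exact_mod_cast hij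
    gcongr
  refine ⟨fun j => sSup (T j) - w / n / ε, hmono, fun y hy0 hwy => ⟨hy0, fun X => ?_⟩⟩
  obtain ⟨m, hmn, hm, hmx⟩ := exists_cdf_discrete_unif_eq hn hmono X
  rw [hm]
  have hye : w / n / ε ≤ y / ε := by gcongr
  constructor
  · rcases hmn.lt_or_eq with hlt | rfl
    · have hX : X < sSup (T m) - w / n / ε := by
        by_contra! h'
        exact lt_irrefl m ((hmx ⟨m, hlt⟩).1 h')
      have h1 := (ProbabilityTheory.cdf μ).mono.leftLim_le (le_refl (X - y / ε))
      suffices ProbabilityTheory.cdf μ (X - y / ε) ≤ (m + w) / n by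
        rw [add_div] at this
        linarith
      have hlt1 : ((m : ℝ) + w) / n < 1 := by
        rw [div_lt_one hn']
        have : (m : ℝ) + 1 ≤ n := by exact_mod_cast hlt
        linarith
      refine le_of_forall_gt_imp_ge_of_dense fun s hs => ?_
      rcases lt_or_ge s 1 with hs1 | hs1
      · refine cdf_le_of_lt_quantile μ (lt_of_le_of_lt (by positivity) hs) ?_
        have := csSup_le (hTne m) (hTle m hlt s hs hs1)
        linarith
      · exact (ProbabilityTheory.cdf_le_one μ _).trans hs1
    · have h1 := (ProbabilityTheory.cdf μ).mono.leftLim_le (le_refl (X - y / ε))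
      have h2 := ProbabilityTheory.cdf_le_one μ (X - y / ε)
      rw [div_self hn'.ne']
      linarith
  · rcases Nat.eq_zero_or_pos m with rfl | hm0
    · have := ProbabilityTheory.cdf_nonneg μ (X + y / ε)
      simp only [Nat.cast_zero, zero_div]
      linarith
    · obtain ⟨j, rfl⟩ : ∃ j, m = j + 1 := ⟨m - 1, by omega⟩
      have hjn : j < n := hmn
      have hX : sSup (T j) - w / n / ε ≤ X := (hmx ⟨j, hjn⟩).2 (Nat.lt_succ_self j)
      suffices ((j : ℝ) + 1 - w) / n ≤ ProbabilityTheory.cdf μ (X + y / ε) by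
        rw [sub_div] at this
        push_cast
        linarith
      refine le_of_forall_lt_imp_le_of_dense fun t ht => ?_
      rcases le_or_gt t 0 with ht0 | ht0
      · exact ht0.trans (ProbabilityTheory.cdf_nonneg μ _)
      · refine le_cdf_of_quantile_le μ (ht.trans_le (hle1 j hjn)) ?_
        have := le_csSup (hTbdd j hjn) (Set.mem_image_of_mem (quantile μ) ⟨ht0, ht⟩)
        linarith

theorem gapBound_of_lt {ε : ℝ} (hε : 0 < ε) {μ : Measure ℝ} {n : ℕ} (hn : 1 ≤ n)
    {x : Fin n → ℝ} (hx : Monotone x) {w : ℝ} (hw : n * dist ε μ (discrete x (unif n)) < w) :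
    GapBound ε μ n w := by
  have hn' : (0 : ℝ) < n := by positivity
  have h : dist ε μ (discrete x (unif n)) < w / n := by
    rwa [lt_div_iff₀ hn', mul_comm]
  obtain ⟨y, hy, hyw⟩ := exists_lt_of_csInf_lt ⟨1, one_mem_admissible_cdf ε μ _⟩ h
  refine (gapBound_of_mem_admissible hε μ hn hx hy).mono hε ?_
  rw [lt_div_iff₀ hn', mul_comm] at hyw
  exact hyw.le

theorem GapBound.exists_dist_le {ε : ℝ} (hε : 0 < ε) {μ : Measure ℝ} {n : ℕ} (hn : 1 ≤ n) {w : ℝ}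
    (hw0 : 0 ≤ w) (hw1 : w < 1) (h : GapBound ε μ n w) :
    ∃ x : Fin n → ℝ, Monotone x ∧ n * dist ε μ (discrete x (unif n)) ≤ w := by
  have hn' : (0 : ℝ) < n := by positivity
  obtain ⟨x, hx, hxy⟩ := h.exists_admissible hε hn hw0 hw1
  refine ⟨x, hx, ?_⟩
  rw [mul_comm, ← le_div_iff₀ hn']
  refine le_of_forall_gt_imp_ge_of_dense fun y hy => ?_
  exact csInf_le (admissible_bddBelow _ _ _)
    (hxy y (lt_of_le_of_lt (by positivity) hy) hy.le)

theorem GapBound.dist_le_of_isBestUniform {ε : ℝ} (hε : 0 < ε) {μ : Measure ℝ} {n : ℕ} (hn : 1 ≤ n)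
    {w : ℝ} (hw0 : 0 ≤ w) (hw1 : w < 1) (h : GapBound ε μ n w) {x : Fin n → ℝ}
    (hx : IsBestUniform ε μ x) : n * dist ε μ (discrete x (unif n)) ≤ w := by
  obtain ⟨x', hx', hle⟩ := h.exists_dist_le hε hn hw0 hw1
  exact (mul_le_mul_of_nonneg_left (hx.2 x' hx') (Nat.cast_nonneg n)).trans hle

theorem exists_isBestUniform {ε : ℝ} (hε : 0 < ε) (μ : Measure ℝ) {n : ℕ} (hn : 1 ≤ n) :
    ∃ x : Fin n → ℝ, IsBestUniform ε μ x := by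
  set W : Set ℝ := {w | 0 ≤ w ∧ GapBound ε μ n w} with hW
  have hhalf : (1 / 2 : ℝ) ∈ W := ⟨by norm_num, gapBound_half ε μ n⟩
  have hbdd : BddBelow W := ⟨0, fun w hw => hw.1⟩
  have h0 : 0 ≤ sInf W := le_csInf ⟨_, hhalf⟩ fun w hw => hw.1
  have h1 : sInf W < 1 := lt_of_le_of_lt (csInf_le hbdd hhalf) (by norm_num)
  have hg : GapBound ε μ n (sInf W) := gapBound_of_forall_gt fun w' hw' => by
    obtain ⟨w, hw, hlt⟩ := exists_lt_of_csInf_lt ⟨_, hhalf⟩ hw'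
    exact hw.2.mono hε hlt.le
  obtain ⟨x, hx, hle⟩ := hg.exists_dist_le hε hn h0 h1
  refine ⟨x, hx, fun y hy => ?_⟩
  have hn' : (0 : ℝ) < n := by positivity
  refine le_of_mul_le_mul_left (hle.trans ?_) hn'
  refine le_of_forall_gt_imp_ge_of_dense fun w hw => ?_
  have hd : 0 ≤ dist ε μ (discrete y (unif n)) := Real.sInf_nonneg fun y hy => hy.1.le
  exact csInf_le hbdd ⟨(lt_of_le_of_lt (by positivity) hw).le, gapBound_of_lt hε hn hy hw⟩

/-! ### Multiples of a real number modulo one -/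

/-- The fractions with odd denominator at most `2 k + 1` (not necessarily in lowest terms). These are
the points whose multiples all have distance at most `k / (2 k + 1)` from the integers. -/
def oddFractions (k : ℕ) : Set ℝ :=
  {p | ∃ (a : ℤ) (i : ℕ), i ≤ k ∧ p = a / (2 * i + 1)}

theorem countable_oddFractions (k : ℕ) : (oddFractions k).Countable := by
  have : oddFractions k ⊆ Set.range fun q : ℤ × ℕ => (q.1 : ℝ) / (2 * q.2 + 1) := by
    rintro p ⟨a, i, -, rfl⟩
    exact ⟨(a, i), rfl⟩
  exact (Set.countable_range _).mono this

theorem mul_sub_intCast_notMem_of_mem_oddFractions {k : ℕ} {p : ℝ} (hp : p ∈ oddFractions k) {w : ℝ}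
    (hw : (k : ℝ) / (2 * k + 1) ≤ w) (n : ℕ) (j : ℤ) : ¬ (w < n * p - j ∧ n * p - j < 1 - w) := by
  obtain ⟨a, i, hik, rfl⟩ := hp
  rintro ⟨h1, h2⟩
  have hb : (0 : ℝ) < 2 * i + 1 := by positivity
  have hwi : (i : ℝ) / (2 * i + 1) ≤ w := by
    refine le_trans ?_ hw
    have : (i : ℝ) ≤ k := by exact_mod_cast hik
    rw [div_le_div_iff₀ hb (by positivity)]
    nlinarith
  have heq : (n : ℝ) * (a / (2 * i + 1)) - j = (n * a - j * (2 * i + 1)) / (2 * i + 1) := by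
    field_simp
  have h3 := lt_of_le_of_lt hwi h1
  have h4 : (n : ℝ) * (a / (2 * i + 1)) - j < 1 - i / (2 * i + 1) := by linarith
  rw [heq, one_sub_div hb.ne', div_lt_div_iff_of_pos_right hb] at h4
  rw [heq, div_lt_div_iff_of_pos_right hb] at h3
  have h5 : (i : ℤ) < n * a - j * (2 * i + 1) := by exact_mod_cast h3
  have h6 : (n : ℤ) * a - j * (2 * i + 1) < i + 1 := by
    have : (n : ℝ) * a - j * (2 * i + 1) < i + 1 := by linarith
    exact_mod_cast this
  omega

/-- Some multiple of `a / b` in lowest terms is `⌊b / 2⌋ / b` modulo one, and the multiplier is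
determined modulo `b` only. -/
theorem frequently_fract_mul_of_rat (x : ℚ) {w : ℝ} (h : w < ((x.den / 2 : ℕ) : ℝ) / x.den) :
    ∃ᶠ n : ℕ in atTop, w < Int.fract (n * (x : ℝ)) ∧ Int.fract (n * (x : ℝ)) < 1 - w := by
  rw [frequently_atTop]
  intro N
  have hden : (0 : ℝ) < x.den := by exact_mod_cast x.den_pos
  set m := x.den / 2
  have hcop : Int.gcd x.num x.den = 1 := x.reduced
  obtain ⟨u, hu⟩ : ∃ u : ℤ, ∃ z : ℤ, u * x.num = m + x.den * z := by
    have := Int.gcd_eq_gcd_ab x.num x.den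
    rw [hcop] at this
    refine ⟨m * Int.gcdA x.num x.den, - (m * Int.gcdB x.num x.den), ?_⟩
    push_cast at this
    linear_combination (-(m : ℤ)) * this
  obtain ⟨z, hz⟩ := hu
  have hd1 : (1 : ℤ) ≤ x.den := by exact_mod_cast x.den_pos
  -- Adding a multiple of the denominator makes the multiplier natural and at least `N`.
  have hnn : (0 : ℤ) ≤ u + x.den * (|u| + N) - N := by
    have := neg_abs_le u
    nlinarith [abs_nonneg u, Int.natCast_nonneg N]
  refine ⟨(u + x.den * (|u| + N)).toNat, by omega, ?_⟩
  have hcast : (((u + x.den * (|u| + N)).toNat : ℕ) : ℝ) = u + x.den * (|u| + N) := by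
    have : (((u + x.den * (|u| + N)).toNat : ℕ) : ℤ) = u + x.den * (|u| + N) :=
      Int.toNat_of_nonneg (by omega)
    exact_mod_cast this
  have hx : (x : ℝ) = x.num / x.den := by exact_mod_cast (Rat.num_div_den x).symm
  have hm : (m : ℝ) / x.den ≤ 1 / 2 := by
    rw [div_le_div_iff₀ hden two_pos]
    have : m * 2 ≤ x.den := Nat.div_mul_le_self _ _
    rw [one_mul]
    exact_mod_cast this
  have hfr : Int.fract ((((u + x.den * (|u| + N)).toNat : ℕ) : ℝ) * (x : ℝ)) = (m : ℝ) / x.den := by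
    rw [Int.fract_eq_iff]
    refine ⟨by positivity, by linarith, z + (|u| + N) * x.num, ?_⟩
    rw [hcast]
    have hz' : (u : ℝ) * x.num = m + x.den * z := by exact_mod_cast hz
    nth_rewrite 1 [hx]
    rw [← sub_eq_zero]
    push_cast
    field_simp
    linear_combination hz'
  rw [hfr]
  constructor <;> linarith

/-- By Dirichlet's approximation theorem some multiple `q x` is very close to, but different from, an
integer; multiples of `q x` then move around the circle in small steps. -/
theorem frequently_fract_mul_of_irrational {x : ℝ} (hx : Irrational x) {w : ℝ} (hw0 : 0 < w)
    (hw : w < 1 / 2) :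
    ∃ᶠ n : ℕ in atTop, w < Int.fract (n * x) ∧ Int.fract (n * x) < 1 - w := by
  rw [frequently_atTop]
  intro N
  obtain ⟨K, hK⟩ := exists_nat_gt (max (N / w) (1 / (1 - 2 * w)))
  have hw2 : 0 < 1 - 2 * w := by linarith
  have hK1 : N / w < K := (le_max_left _ _).trans_lt hK
  have hK2 : 1 / (1 - 2 * w) < K := (le_max_right _ _).trans_lt hK
  have hK0 : (0 : ℝ) < K := lt_trans (by positivity) hK2
  obtain ⟨q, hq0, -, hq⟩ := Real.exists_nat_abs_mul_sub_round_le x (n := K) (by exact_mod_cast hK0)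
  set r := (q : ℝ) * x - round (q * x) with hr
  have hr0 : r ≠ 0 := by
    have : Irrational ((q : ℝ) * x) := hx.natCast_mul hq0.ne'
    exact sub_ne_zero.2 (this.ne_int _)
  have habs : 0 < |r| := abs_pos.2 hr0
  have hrK : |r| * K < 1 := by
    have : |r| * (K + 1) ≤ 1 := by rwa [le_div_iff₀ (by positivity)] at hq
    nlinarith
  have hrw : |r| < 1 - 2 * w := by
    rw [div_lt_iff₀ hw2] at hK2
    nlinarith
  -- The first multiple of `|r|` beyond `w`; a step is shorter than `1 - 2 * w`.
  set m := ⌊w / |r|⌋₊ + 1 with hm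
  have hm1 : w < m * |r| := by
    have := Nat.lt_floor_add_one (w / |r|)
    rw [div_lt_iff₀ habs] at this
    simpa [hm] using this
  have hm2 : m * |r| < 1 - w := by
    have := Nat.floor_le (a := w / |r|) (by positivity)
    rw [le_div_iff₀ habs] at this
    have h' : (m : ℝ) * |r| = ⌊w / |r|⌋₊ * |r| + |r| := by rw [hm]; push_cast; ring
    linarith
  have hNm : N ≤ m := by
    have h1 : (N : ℝ) < w * K := by rwa [div_lt_iff₀ hw0, mul_comm] at hK1
    have h2 : w * K < m := by
      have : w * K < m * |r| * K := by gcongr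
      have h3 : (m : ℝ) * (|r| * K) ≤ m * 1 := by gcongr
      linarith
    exact_mod_cast (h1.trans h2).le
  refine ⟨m * q, hNm.trans (Nat.le_mul_of_pos_right m hq0), ?_⟩
  have hmq : ((m * q : ℕ) : ℝ) * x = m * r + (m * round ((q : ℝ) * x) : ℤ) := by
    rw [hr]; push_cast; ring
  rw [hmq, Int.fract_add_intCast]
  rcases hr0.lt_or_gt with hneg | hpos
  · rw [abs_of_neg hneg] at hm1 hm2
    have : Int.fract ((m : ℝ) * r) = 1 + m * r := by
      rw [Int.fract_eq_iff]
      exact ⟨by linarith, by linarith, -1, by push_cast; ring⟩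
    rw [this]
    constructor <;> linarith
  · rw [abs_of_pos hpos] at hm1 hm2
    rw [Int.fract_eq_self.2 ⟨by linarith, by linarith⟩]
    exact ⟨hm1, hm2⟩

theorem frequently_fract_mul_of_notMem_oddFractions {k : ℕ} {x : ℝ} (hx : x ∉ oddFractions k)
    {w : ℝ} (hw0 : 0 < w) (hw : w < (k + 1) / (2 * k + 3)) :
    ∃ᶠ n : ℕ in atTop, w < Int.fract (n * x) ∧ Int.fract (n * x) < 1 - w := by
  have hk : ((k : ℝ) + 1) / (2 * k + 3) < 1 / 2 := by
    rw [div_lt_div_iff₀ (by positivity) two_pos]; linarith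
  by_cases hirr : Irrational x
  · exact frequently_fract_mul_of_irrational hirr hw0 (hw.trans hk)
  · obtain ⟨y, rfl⟩ : ∃ y : ℚ, (y : ℝ) = x := by simpa [Irrational] using hirr
    refine frequently_fract_mul_of_rat y ?_
    have hden : (0 : ℝ) < y.den := by exact_mod_cast y.den_pos
    have hy : (y : ℝ) = y.num / y.den := by exact_mod_cast (Rat.num_div_den y).symm
    refine hw.trans_le ?_
    rcases Nat.even_or_odd' y.den with ⟨m, hm | hm⟩
    · have hm' : (y.den : ℝ) = 2 * m := by exact_mod_cast hm
      have hm0 : (m : ℝ) ≠ 0 := by rintro h; rw [h] at hm'; linarith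
      have : ((y.den / 2 : ℕ) : ℝ) / y.den = 1 / 2 := by
        rw [hm', hm, Nat.mul_div_cancel_left _ two_pos]
        field_simp
      rw [this]
      exact hk.le
    · have hm' : (y.den : ℝ) = 2 * m + 1 := by exact_mod_cast hm
      have hkm : k + 1 ≤ m := by
        by_contra! h
        exact hx ⟨y.num, m, by omega, by rw [hy, hm']⟩
      have hkm' : (k : ℝ) + 1 ≤ m := by exact_mod_cast hkm
      have : y.den / 2 = m := by omega
      rw [this, hm', div_le_div_iff₀ (by positivity) (by positivity)]
      nlinarith

/-! ### The inverse measure of the intervals of levels -/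

theorem inverseMeasure_Ioc (μ : Measure ℝ) {s t : ℝ} (hs : 0 < s) (hst : s ≤ t) (ht : t < 1) :
    inverseMeasure μ (Set.Ioc s t) = ENNReal.ofReal (quantile μ t - quantile μ s) := by
  have hs' : s ∈ Set.Ioo (0 : ℝ) 1 := ⟨hs, by linarith⟩
  have ht' : t ∈ Set.Ioo (0 : ℝ) 1 := ⟨by linarith, ht⟩
  rw [inverseMeasure, Measure.map_apply measurable_subtype_coe measurableSet_Ioc]
  exact (quantileStieltjes μ).measure_Ioc ⟨s, hs'⟩ ⟨t, ht'⟩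

theorem inverseMeasure_compl_Ioo (μ : Measure ℝ) : inverseMeasure μ (Set.Ioo 0 1)ᶜ = 0 := by
  rw [inverseMeasure, Measure.map_apply measurable_subtype_coe measurableSet_Ioo.compl]
  convert measure_empty (μ := (quantileStieltjes μ).measure)
  ext z
  simp

instance sFinite_inverseMeasure (μ : Measure ℝ) : SFinite (inverseMeasure μ) := by
  unfold inverseMeasure
  infer_instance

theorem measure_Ioo_le_of_forall_Ioc {ν : Measure ℝ} {a b : ℝ} {C : ℝ≥0∞}
    (h : ∀ s t, a < s → s ≤ t → t < b → ν (Set.Ioc s t) ≤ C) : ν (Set.Ioo a b) ≤ C := by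
  rcases le_or_gt b a with hab | hab
  · simp [Set.Ioo_eq_empty_of_le hab]
  obtain ⟨u, hu, hum, hul⟩ := exists_seq_strictAnti_tendsto' hab
  obtain ⟨v, hv, hvm, hvl⟩ := exists_seq_strictMono_tendsto' hab
  have hmono : Monotone fun i => Set.Ioc (u i) (v i) := fun i i' hi =>
    Set.Ioc_subset_Ioc (hu.antitone hi) (hv.monotone hi)
  have hsub : Set.Ioo a b ⊆ ⋃ i, Set.Ioc (u i) (v i) := fun z hz => by
    obtain ⟨i, hi1, hi2⟩ := ((hul.eventually_lt_const hz.1).and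
      (hvl.eventually_const_lt hz.2)).exists
    exact Set.mem_iUnion.2 ⟨i, hi1, hi2.le⟩
  refine (measure_mono hsub).trans ?_
  rw [hmono.measure_iUnion]
  refine iSup_le fun i => ?_
  rcases le_total (u i) (v i) with hi | hi
  · exact h _ _ (hum i).1 hi (hvm i).2
  · simp [Set.Ioc_eq_empty_of_le hi]

theorem GapBound.inverseMeasure_Ioo_le {ε : ℝ} {μ : Measure ℝ} {n : ℕ} {w : ℝ} (hw : 0 ≤ w)
    (h : GapBound ε μ n w) {j : ℕ} (hj : j < n) :
    inverseMeasure μ (Set.Ioo ((j + w) / n) ((j + 1 - w) / n)) ≤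
      ENNReal.ofReal (2 * w / (n * ε)) := by
  refine measure_Ioo_le_of_forall_Ioc fun s t hs hst ht => ?_
  have hn' : (0 : ℝ) < n := by exact_mod_cast (Nat.zero_le j).trans_lt hj
  have h0 : (0 : ℝ) ≤ (j + w) / n := by positivity
  have h1 : ((j : ℝ) + 1 - w) / n ≤ 1 := by
    rw [div_le_one hn']
    have : (j : ℝ) + 1 ≤ n := by exact_mod_cast hj
    linarith
  rw [inverseMeasure_Ioc μ (by linarith) hst (by linarith)]
  exact ENNReal.ofReal_le_ofReal (h j hj s t hs hst ht)

/-! ### Absolute continuity away from the fractions with small odd denominator -/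

theorem floor_mul_lt {x : ℝ} (hx : x ∈ Set.Ioo (0 : ℝ) 1) {n : ℕ} (hn : 1 ≤ n) :
    ⌊n * x⌋₊ < n := by
  have hn' : (0 : ℝ) < n := by positivity
  rw [Nat.floor_lt (mul_nonneg hn'.le hx.1.le)]
  nlinarith [hx.2]

/-- For `x` outside `oddFractions k` there are infinitely many `n` for which `n x` is so far from
the integers that a level interval contains an interval centred at `x` of length comparable to
`1 / n`. This bounds a lower derivative of the inverse measure at `x`. -/
theorem exists_inverseMeasure_le_of_eventually_gapBound {ε : ℝ} {μ : Measure ℝ}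
    {k : ℕ} {w : ℝ} (hw0 : 0 < w) (hw : w < (k + 1) / (2 * k + 3))
    (h : ∀ᶠ n : ℕ in atTop, GapBound ε μ n w) :
    ∃ C : ℝ, ∀ s : Set ℝ, inverseMeasure μ (s \ oddFractions k) ≤
      (ENNReal.ofReal C • volume : Measure ℝ) s := by
  obtain ⟨w', hww', hw'⟩ := exists_between hw
  set δ := w' - w with hδ
  have hδ0 : 0 < δ := sub_pos.2 hww'
  refine ⟨w / (δ * ε), fun s => ?_⟩
  have hae : inverseMeasure μ (s \ oddFractions k) =
      inverseMeasure μ ((s \ oddFractions k) ∩ Set.Ioo 0 1) :=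
    (measure_inter_conull (inverseMeasure_compl_Ioo μ)).symm
  rw [hae]
  have hsub : (s \ oddFractions k) ∩ Set.Ioo 0 1 ⊆ s := fun z hz => hz.1.1
  refine le_trans ?_ (measure_mono hsub)
  have : IsLocallyFiniteMeasure (ENNReal.ofReal (w / (δ * ε)) • volume : Measure ℝ) :=
    (inferInstance : IsLocallyFiniteMeasure ((w / (δ * ε)).toNNReal • volume : Measure ℝ))
  refine (Besicovitch.vitaliFamily (inverseMeasure μ)).measure_le_of_frequently_le _
    Measure.AbsolutelyContinuous.rfl _ fun x hx => ?_
  have hlim : Tendsto (fun n : ℕ => δ / n) atTop (𝓝[>] 0) := by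
    refine tendsto_nhdsWithin_iff.2 ⟨tendsto_const_div_atTop_nhds_zero_nat δ, ?_⟩
    filter_upwards [eventually_ge_atTop 1] with n hn
    have : (0 : ℝ) < n := by positivity
    exact div_pos hδ0 this
  refine ((Besicovitch.tendsto_filterAt (inverseMeasure μ) x).comp hlim).frequently ?_
  refine ((frequently_fract_mul_of_notMem_oddFractions hx.1.2 (hw0.trans hww') hw').and_eventually
    (h.and (eventually_ge_atTop 1))).mono ?_
  rintro n ⟨⟨h1, h2⟩, hg, hn⟩
  have hn' : (0 : ℝ) < n := by positivity
  have hnx : 0 ≤ n * x := mul_nonneg hn'.le hx.2.1.le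
  have hfl : Int.fract (n * x) = n * x - ⌊n * x⌋₊ := by
    rw [Int.fract, natCast_floor_eq_intCast_floor hnx]
  rw [hfl] at h1 h2
  simp only [Function.comp_apply, Real.closedBall_eq_Icc, Measure.smul_apply, Real.volume_Icc,
    smul_eq_mul]
  refine (measure_mono ?_).trans ((hg.inverseMeasure_Ioo_le hw0.le (floor_mul_lt hx.2 hn)).trans ?_)
  · intro z hz
    have e1 : x - δ / n = (n * x - δ) / n := by field_simp
    have e2 : x + δ / n = (n * x + δ) / n := by field_simp
    rw [e1, e2] at hz
    refine ⟨lt_of_lt_of_le ?_ hz.1, lt_of_le_of_lt hz.2 ?_⟩ <;>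
    · refine div_lt_div_of_pos_right ?_ hn'
      linarith
  · rw [← ENNReal.ofReal_mul' (by have := div_nonneg hδ0.le hn'.le; linarith)]
    refine ENNReal.ofReal_le_ofReal (le_of_eq ?_)
    field_simp
    ring

/-! ### From infinitely many `n` to all `n` -/

/-- Infinitely many bounds with constant `w` force the density of the absolutely continuous part to
be at most `2 w / ((1 - 2 w) ε)`: by Lebesgue differentiation along the level intervals, which need
not be centred at the point but lie at a distance comparable to their length. -/
theorem inverseMeasure_le_of_frequently_gapBound {ε : ℝ} {μ : Measure ℝ} {P : Set ℝ}
    (hP : P.Countable) {C : ℝ} (hC : ∀ s : Set ℝ, inverseMeasure μ (s \ P) ≤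
      (ENNReal.ofReal C • volume : Measure ℝ) s)
    {w : ℝ} (hw0 : 0 ≤ w) (hw : w < 1 / 2) (h : ∃ᶠ n : ℕ in atTop, GapBound ε μ n w) (s : Set ℝ) :
    inverseMeasure μ (s \ P) ≤
      (ENNReal.ofReal (2 * w / ((1 - 2 * w) * ε)) • volume : Measure ℝ) s := by
  have hw2 : 0 < 1 - 2 * w := by linarith
  set M := 2 * w / ((1 - 2 * w) * ε) with hM
  set ρ := (inverseMeasure μ).restrict Pᶜ with hρ
  have hρs : ∀ s, ρ s = inverseMeasure μ (s \ P) := fun s => by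
    rw [hρ, Measure.restrict_apply' hP.measurableSet.compl, Set.sdiff_eq]
  have hac : ρ ≪ volume := fun t ht => by
    rw [hρs]
    refine le_antisymm ((hC t).trans ?_) zero_le
    simp [ht]
  rw [← hρs]
  have hnull : ρ (Set.Ioo 0 1)ᶜ = 0 :=
    le_antisymm ((Measure.restrict_apply_le _ _).trans (inverseMeasure_compl_Ioo μ).le) zero_le
  rw [← measure_inter_conull hnull]
  refine le_trans ?_ (measure_mono (Set.inter_subset_left (t := Set.Ioo 0 1)))
  have : IsLocallyFiniteMeasure (ENNReal.ofReal M • volume : Measure ℝ) :=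
    (inferInstance : IsLocallyFiniteMeasure (M.toNNReal • volume : Measure ℝ))
  refine (IsUnifLocDoublingMeasure.vitaliFamily (volume : Measure ℝ)
    (1 / (1 - 2 * w))).measure_le_of_frequently_le _ hac _ fun x hx => ?_
  have hlim : Tendsto (fun n : ℕ => (1 - 2 * w) / 2 / n) atTop (𝓝[>] 0) := by
    refine tendsto_nhdsWithin_iff.2 ⟨tendsto_const_div_atTop_nhds_zero_nat _, ?_⟩
    filter_upwards [eventually_ge_atTop 1] with n hn
    have : (0 : ℝ) < n := by positivity
    exact div_pos (by linarith) this
  refine (IsUnifLocDoublingMeasure.tendsto_closedBall_filterAt volume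
    (fun n : ℕ => ((⌊n * x⌋₊ : ℝ) + 1 / 2) / n) _ hlim ?_).frequently ?_
  · filter_upwards [eventually_ge_atTop 1] with n hn
    have hn' : (0 : ℝ) < n := by positivity
    have e1 : 1 / (1 - 2 * w) * ((1 - 2 * w) / 2 / n) = 1 / 2 / n := by field_simp
    have e2 : x = n * x / n := by field_simp
    rw [e1, Real.closedBall_eq_Icc, ← sub_div, ← add_div]
    have h1 := Nat.floor_le (mul_nonneg hn'.le hx.2.1.le)
    have h2 := Nat.lt_floor_add_one (n * x)
    constructor
    · rw [div_le_iff₀ hn']; linarith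
    · rw [le_div_iff₀ hn']; linarith
  · refine (h.and_eventually (eventually_ge_atTop 1)).mono ?_
    rintro n ⟨hg, hn⟩
    have hn' : (0 : ℝ) < n := by positivity
    have e1 : ((⌊n * x⌋₊ : ℝ) + 1 / 2) / n - (1 - 2 * w) / 2 / n = (⌊n * x⌋₊ + w) / n := by ring
    have e2 : ((⌊n * x⌋₊ : ℝ) + 1 / 2) / n + (1 - 2 * w) / 2 / n = (⌊n * x⌋₊ + 1 - w) / n := by
      ring
    simp only [Real.closedBall_eq_Icc, e1, e2, Measure.smul_apply, Real.volume_Icc, smul_eq_mul]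
    rw [← measure_congr (hac.ae_eq Ioo_ae_eq_Icc)]
    refine (Measure.restrict_apply_le _ _).trans
      ((hg.inverseMeasure_Ioo_le hw0 (floor_mul_lt hx.2 hn)).trans ?_)
    have e3 : ((⌊n * x⌋₊ : ℝ) + 1 - w) / n - (⌊n * x⌋₊ + w) / n = (1 - 2 * w) / n := by ring
    rw [e3, ← ENNReal.ofReal_mul' (by positivity)]
    refine ENNReal.ofReal_le_ofReal (le_of_eq ?_)
    rw [hM]
    field_simp

/-- For `w ≥ k / (2 k + 1)` the level intervals contain none of the points of `oddFractions k`, so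
that a bound for the absolutely continuous part suffices. -/
theorem gapBound_of_inverseMeasure_le {ε : ℝ} (hε : 0 < ε) {μ : Measure ℝ} {k : ℕ} {w : ℝ}
    (hkw : (k : ℝ) / (2 * k + 1) ≤ w) (hw : w < 1 / 2)
    (h : ∀ s : Set ℝ, inverseMeasure μ (s \ oddFractions k) ≤
      (ENNReal.ofReal (2 * w / ((1 - 2 * w) * ε)) • volume : Measure ℝ) s) (n : ℕ) :
    GapBound ε μ n w := by
  intro j hj s t hs hst ht
  have hw0 : 0 ≤ w := le_trans (by positivity) hkw
  have hw2 : 0 < 1 - 2 * w := by linarith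
  have hn' : (0 : ℝ) < n := by exact_mod_cast (Nat.zero_le j).trans_lt hj
  have h0 : (0 : ℝ) ≤ (j + w) / n := by positivity
  have h1 : ((j : ℝ) + 1 - w) / n ≤ 1 := by
    rw [div_le_one hn']
    have : (j : ℝ) + 1 ≤ n := by exact_mod_cast hj
    linarith
  have hdisj : Set.Ioc s t \ oddFractions k = Set.Ioc s t := by
    refine sdiff_eq_left.2 (Set.disjoint_left.2 fun z hz hzP => ?_)
    refine mul_sub_intCast_notMem_of_mem_oddFractions hzP hkw n j ⟨?_, ?_⟩
    · have := hs.trans hz.1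
      rw [div_lt_iff₀ hn'] at this
      push_cast
      linarith
    · have := hz.2.trans_lt ht
      rw [lt_div_iff₀ hn'] at this
      push_cast
      linarith
  have hm := h (Set.Ioc s t)
  rw [hdisj, inverseMeasure_Ioc μ (by linarith) hst (by linarith), Measure.smul_apply,
    Real.volume_Ioc, smul_eq_mul, ← ENNReal.ofReal_mul' (by linarith),
    ENNReal.ofReal_le_ofReal_iff (mul_nonneg (by positivity) (by linarith))] at hm
  have hlen : t - s ≤ (1 - 2 * w) / n := by
    have : ((j : ℝ) + 1 - w) / n - (j + w) / n = (1 - 2 * w) / n := by ring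
    linarith
  calc quantile μ t - quantile μ s
      ≤ 2 * w / ((1 - 2 * w) * ε) * (t - s) := hm
    _ ≤ 2 * w / ((1 - 2 * w) * ε) * ((1 - 2 * w) / n) := by gcongr
    _ = 2 * w / (n * ε) := by field_simp

/-! ### Limits of the scaled distances -/

/-- The sequence `n d_ε(μ, δ)` for a choice of uniform discrete measures `δ` with `n` locations. -/
noncomputable def scaledDist (ε : ℝ) (μ : Measure ℝ) (x : (n : ℕ) → Fin n → ℝ) (n : ℕ) : ℝ :=
  n * dist ε μ (discrete (x n) (unif n))

theorem scaledDist_nonneg (ε : ℝ) (μ : Measure ℝ) (x : (n : ℕ) → Fin n → ℝ) (n : ℕ) :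
    0 ≤ scaledDist ε μ x n :=
  mul_nonneg (Nat.cast_nonneg n) (Real.sInf_nonneg fun _ hy => hy.1.le)

section Limits

variable {ε : ℝ} {μ : Measure ℝ} {x : (n : ℕ) → Fin n → ℝ}

theorem eventually_scaledDist_le (hε : 0 < ε) (hx : ∀ n : ℕ, 1 ≤ n → IsBestUniform ε μ (x n)) :
    ∀ᶠ n in atTop, scaledDist ε μ x n ≤ 1 / 2 := by
  filter_upwards [eventually_ge_atTop 1] with n hn
  exact (gapBound_half ε μ n).dist_le_of_isBestUniform hε hn (by norm_num) (by norm_num) (hx n hn)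

theorem isBoundedUnder_le_scaledDist (hε : 0 < ε)
    (hx : ∀ n : ℕ, 1 ≤ n → IsBestUniform ε μ (x n)) :
    IsBoundedUnder (· ≤ ·) atTop (scaledDist ε μ x) :=
  isBoundedUnder_of_eventually_le (eventually_scaledDist_le hε hx)

theorem isBoundedUnder_ge_scaledDist : IsBoundedUnder (· ≥ ·) atTop (scaledDist ε μ x) :=
  isBoundedUnder_of ⟨0, scaledDist_nonneg ε μ x⟩

theorem exists_inverseMeasure_le_of_limsup_lt (hε : 0 < ε)
    (hx : ∀ n : ℕ, 1 ≤ n → IsBestUniform ε μ (x n)) {k : ℕ}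
    (hk : limsup (scaledDist ε μ x) atTop < (k + 1) / (2 * k + 3)) :
    ∃ C : ℝ, ∀ s : Set ℝ, inverseMeasure μ (s \ oddFractions k) ≤
      (ENNReal.ofReal C • volume : Measure ℝ) s := by
  obtain ⟨w, hLw, hwk⟩ := exists_between
    (max_lt hk (show (0 : ℝ) < (k + 1) / (2 * k + 3) by positivity))
  obtain ⟨hLw, hw0⟩ := max_lt_iff.1 hLw
  refine exists_inverseMeasure_le_of_eventually_gapBound (ε := ε) hw0 hwk ?_
  filter_upwards [eventually_lt_of_limsup_lt hLw (isBoundedUnder_le_scaledDist hε hx),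
    eventually_ge_atTop 1] with n hn hn1
  exact gapBound_of_lt hε hn1 (hx n hn1).1 hn

/-- Between two consecutive values `k / (2 k + 1)` and `(k + 1) / (2 k + 3)` the limit superior is
governed by the absolutely continuous part of the inverse measure, which is seen by every `n`. -/
theorem tendsto_scaledDist_of_limsup_lt (hε : 0 < ε)
    (hx : ∀ n : ℕ, 1 ≤ n → IsBestUniform ε μ (x n)) {k : ℕ}
    (hk : limsup (scaledDist ε μ x) atTop < (k + 1) / (2 * k + 3))
    (hk' : k = 0 ∨ (k : ℝ) / (2 * k + 1) < limsup (scaledDist ε μ x) atTop) :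
    Tendsto (scaledDist ε μ x) atTop (𝓝 (limsup (scaledDist ε μ x) atTop)) := by
  have hle := isBoundedUnder_le_scaledDist hε hx
  have hge : IsBoundedUnder (· ≥ ·) atTop (scaledDist ε μ x) := isBoundedUnder_ge_scaledDist
  refine tendsto_of_le_liminf_of_limsup_le ?_ le_rfl hle hge
  by_contra! hlt
  have hl0 : 0 ≤ liminf (scaledDist ε μ x) atTop :=
    le_liminf_of_le hle.isCoboundedUnder_ge (Eventually.of_forall (scaledDist_nonneg ε μ x))
  have hkL : (k : ℝ) / (2 * k + 1) < limsup (scaledDist ε μ x) atTop := by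
    rcases hk' with rfl | h
    · simpa using lt_of_le_of_lt hl0 hlt
    · exact h
  obtain ⟨w, hw, hwL⟩ := exists_between (max_lt hlt hkL)
  obtain ⟨hlw, hkw⟩ := max_lt_iff.1 hw
  have hw0 : 0 ≤ w := hl0.trans hlw.le
  have hw2 : w < 1 / 2 := (hwL.trans hk).trans (by
    rw [div_lt_div_iff₀ (by positivity) two_pos]; linarith)
  obtain ⟨C, hC⟩ := exists_inverseMeasure_le_of_limsup_lt hε hx hk
  have hfreq : ∃ᶠ n : ℕ in atTop, GapBound ε μ n w := by
    refine ((frequently_lt_of_liminf_lt hle.isCoboundedUnder_ge hlw).and_eventually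
      (eventually_ge_atTop 1)).mono ?_
    rintro n ⟨h1, h2⟩
    exact gapBound_of_lt hε h2 (hx n h2).1 h1
  have hall := gapBound_of_inverseMeasure_le hε hkw.le hw2
    (inverseMeasure_le_of_frequently_gapBound (countable_oddFractions k) hC hw0 hw2 hfreq)
  refine absurd hwL (not_lt.2 (limsup_le_of_le hge.isCoboundedUnder_le ?_))
  filter_upwards [eventually_ge_atTop 1] with n hn
  exact (hall n).dist_le_of_isBestUniform hε hn hw0 (by linarith) (hx n hn)

theorem inverseMeasure_absolutelyContinuous_of_limsup_lt (hε : 0 < ε)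
    (hx : ∀ n : ℕ, 1 ≤ n → IsBestUniform ε μ (x n))
    (h : limsup (scaledDist ε μ x) atTop < 1 / 3) : inverseMeasure μ ≪ volume := by
  obtain ⟨C, hC⟩ := exists_inverseMeasure_le_of_limsup_lt hε hx (k := 0) (by simpa using h)
  intro s hs
  have h1 : inverseMeasure μ (s \ oddFractions 0) = 0 :=
    le_antisymm ((hC s).trans (by simp [hs])) zero_le
  -- The exceptional set consists of the integers, which carry no mass.
  have h2 : oddFractions 0 ⊆ (Set.Ioo 0 1)ᶜ := by
    rintro _ ⟨a, i, hi, rfl⟩ ⟨ha0, ha1⟩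
    obtain rfl : i = 0 := by omega
    norm_num at ha0 ha1
    have : a < 1 := by exact_mod_cast ha1
    omega
  exact measure_mono_null (Set.subset_sdiff_union s (oddFractions 0))
    (measure_union_null h1 (measure_mono_null h2 (inverseMeasure_compl_Ioo μ)))

end Limits

theorem Omega_two_mul_natCast (m : ℕ) :
    Omega (2 * (((m : ℕ∞) : ℝ≥0∞) : EReal)) = (m : ℝ) / (2 * m + 1) := by
  have h : (2 * (((m : ℕ∞) : ℝ≥0∞) : EReal)) = ((2 * m : ℝ) : EReal) := by
    rw [EReal.coe_mul, EReal.coe_natCast, ENat.toENNReal_coe, ← ENNReal.ofReal_natCast,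
      EReal.coe_ennreal_ofReal, max_eq_left (Nat.cast_nonneg m), EReal.coe_natCast]
    rfl
  rw [h, Omega, if_neg (EReal.coe_ne_top _), if_neg (EReal.coe_ne_bot _), EReal.toReal_coe,
    abs_of_nonneg (by positivity)]
  have : (2 : ℝ) + 2 * (2 * m) = 2 * (2 * m + 1) := by ring
  rw [this, mul_div_mul_left _ _ two_ne_zero]

theorem Omega_two_mul_top : Omega (2 * (((⊤ : ℕ∞) : ℝ≥0∞) : EReal)) = 1 / 2 := by
  have h : (2 * (((⊤ : ℕ∞) : ℝ≥0∞) : EReal)) = ⊤ := by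
    simp [EReal.mul_top_of_pos]
  rw [h, Omega, if_pos rfl]

theorem omegaValues_eq :
    OmegaValues = insert (1 / 2) {y : ℝ | ∃ m : ℕ, 1 ≤ m ∧ y = (m : ℝ) / (2 * m + 1)} := by
  ext y
  simp only [OmegaValues, Set.mem_ofPred_eq, Set.mem_insert_iff]
  constructor
  · rintro ⟨m, hm, rfl⟩
    induction m using ENat.recTopCoe with
    | top => exact Or.inl Omega_two_mul_top
    | coe m => exact Or.inr ⟨m, by exact_mod_cast hm, Omega_two_mul_natCast m⟩
  · rintro (rfl | ⟨m, hm, rfl⟩)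
    · exact ⟨⊤, le_top, Omega_two_mul_top.symm⟩
    · exact ⟨m, by exact_mod_cast hm, (Omega_two_mul_natCast m).symm⟩

theorem exists_between_omegaValues {L : ℝ} (h3 : 1 / 3 ≤ L) (h2 : L ≤ 1 / 2)
    (hL : L ∉ OmegaValues) :
    ∃ k : ℕ, (k : ℝ) / (2 * k + 1) < L ∧ L < (k + 1) / (2 * k + 3) := by
  rw [omegaValues_eq, Set.mem_insert_iff, not_or] at hL
  have hlt : 0 < 1 / 2 - L := sub_pos.2 (lt_of_le_of_ne h2 hL.1)
  have hex : ∃ k : ℕ, L < ((k : ℝ) + 1) / (2 * k + 3) := by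
    obtain ⟨k, hk⟩ := exists_nat_gt (1 / (1 / 2 - L))
    refine ⟨k, ?_⟩
    rw [div_lt_iff₀ hlt] at hk
    rw [lt_div_iff₀ (by positivity)]
    nlinarith
  classical
  have hspec := Nat.find_spec hex
  refine ⟨Nat.find hex, ?_, hspec⟩
  rcases Nat.eq_zero_or_pos (Nat.find hex) with h0 | h0
  · rw [h0]
    norm_num
    linarith
  · obtain ⟨m, hm⟩ : ∃ m, Nat.find hex = m + 1 := ⟨Nat.find hex - 1, by omega⟩
    have hmin := Nat.find_min hex (m := m) (by omega)
    rw [not_lt] at hmin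
    have he : (2 : ℝ) * (m + 1 : ℕ) + 1 = 2 * m + 3 := by push_cast; ring
    rw [hm, he]
    refine lt_of_le_of_ne (by exact_mod_cast hmin) fun heq => hL.2 ⟨m + 1, by omega, ?_⟩
    rw [he, heq]

end Levy

theorem mainTheorem7 (μ : Measure ℝ) [IsProbabilityMeasure μ] (ε : ℝ) (hε : 0 < ε) :
    (∀ n : ℕ, 1 ≤ n → ∃ x : Fin n → ℝ, Levy.IsBestUniform ε μ x) ∧
    (∀ x : (n : ℕ) → Fin n → ℝ, (∀ n : ℕ, 1 ≤ n → Levy.IsBestUniform ε μ (x n)) →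
      (limsup (fun n : ℕ => (n : ℝ) * Levy.dist ε μ (Levy.discrete (x n) (Levy.unif n))) atTop
          < 1 / 3 →
        (∃ l : ℝ, Tendsto
          (fun n : ℕ => (n : ℝ) * Levy.dist ε μ (Levy.discrete (x n) (Levy.unif n)))
          atTop (𝓝 l)) ∧
        Levy.inverseMeasure μ ≪ volume) ∧
      (1 / 3 ≤
          limsup (fun n : ℕ => (n : ℝ) * Levy.dist ε μ (Levy.discrete (x n) (Levy.unif n))) atTop →
        (∃ l : ℝ, Tendsto
          (fun n : ℕ => (n : ℝ) * Levy.dist ε μ (Levy.discrete (x n) (Levy.unif n)))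
          atTop (𝓝 l)) ∨
        limsup (fun n : ℕ => (n : ℝ) * Levy.dist ε μ (Levy.discrete (x n) (Levy.unif n))) atTop
          ∈ Levy.OmegaValues)) ∧
    Levy.OmegaValues = insert (1 / 2) {y : ℝ | ∃ m : ℕ, 1 ≤ m ∧ y = (m : ℝ) / (2 * m + 1)} := by
  refine ⟨fun n hn => Levy.exists_isBestUniform hε μ hn, fun x hx => ⟨fun h => ?_, fun h => ?_⟩,
    Levy.omegaValues_eq⟩
  · exact ⟨⟨_, Levy.tendsto_scaledDist_of_limsup_lt hε hx (k := 0)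
      (lt_of_lt_of_eq h (by norm_num)) (Or.inl rfl)⟩,
      Levy.inverseMeasure_absolutelyContinuous_of_limsup_lt hε hx h⟩
  · refine or_iff_not_imp_right.2 fun hL => ?_
    have h2 : limsup (Levy.scaledDist ε μ x) atTop ≤ 1 / 2 :=
      limsup_le_of_le Levy.isBoundedUnder_ge_scaledDist.isCoboundedUnder_le
        (Levy.eventually_scaledDist_le hε hx)
    obtain ⟨k, hk1, hk2⟩ := Levy.exists_between_omegaValues h h2 hL
    exact ⟨_, Levy.tendsto_scaledDist_of_limsup_lt hε hx hk2 (Or.inr hk1)⟩
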